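/- Let $S$ be a semitopological semigroup, i.e. a semigroup with a topology for which all left translations $l_s:t\mapsto st$ and all right translations $t\mapsto ts$ are continuous. Let $C(S)$ be the $C^*$-algebra of bounded continuous functions $S\to\mathbb C$ with the supremum norm, and put $L_sf=f\circ l_s$. Let $LMC(S)$ be the set of all $f\in C(S)$ such that $s\mapsto\mu(L_sf)$ is continuous on $S$ for every $\mu$ in the spectrum of $C(S)$; it is a left translation invariant unital $C^*$-subalgebra of $C(S)$, with spectrum $S^{LMC}$. For $\mu\in S^{LMC}$ and $f\in LMC(S)$ put $(T_\mu f)(s)=\mu(L_sf)$, and let $\Sigma=\{T_\mu:\mu\in S^{LMC}\}$. Let $F_0$ be the set of constant functions on $S$ of modulus $1$ and, for $k\ge 1$, let $$F_k=\{f\in LMC(S): |f|=1 \text{ and for every } \sigma\in\Sigma \text{ there is } f_\sigma\in F_{k-1} \text{ with } \sigma(f)=f_\sigma f\}.$$ Let $W_k(S)$ be the norm closure in $C(S)$ of the algebra generated by $F_k$. Let $SAP(S)$, the space of strongly almost periodic functions, be the closed linear span in $C(S)$ of the coefficients $s\mapsto\langle U_s\xi,\eta\rangle$ of all continuous finite-dimensional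 unitary representations $U$ of $S$. (i) For every abelian semitopological semigroup $S$ and every integer $k\ge 1$, $SAP(S)\subseteq W_k(S)$. (ii) For every abelian semitopological semigroup $S$ with a left identity, $W_1(S)=SAP(S)$. -/

import Mathlib

open scoped BoundedContinuousFunction

namespace WeylAlgebra

noncomputable section

/-- The left translation `l_s : t ↦ s * t` of a semitopological semigroup (a semigroup in which
all left and right translations are continuous), as a continuous map. -/
def leftMul {S : Type*} [Semigroup S] [TopologicalSpace S] [SeparatelyContinuousMul S] (s : S) :
    C(S, S) :=
  ⟨fun t => s * t, continuous_const_mul s⟩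

/-- The left translate `L_s f = f ∘ l_s` of `f ∈ C(S)`. -/
def leftTranslate {S : Type*} [Semigroup S] [TopologicalSpace S] [SeparatelyContinuousMul S]
    (s : S) (f : S →ᵇ ℂ) : S →ᵇ ℂ :=
  f.compContinuous (leftMul s)

/-- `LMC(S)`, the left multiplicatively continuous functions: those `f ∈ C(S)` for which
`s ↦ μ (L_s f)` is continuous for every `μ` in the spectrum of `C(S)`
(boundedness of `s ↦ μ (L_s f)` is automatic). It is a unital `C⋆`-subalgebra of `C(S)`. -/
def LMC (S : Type*) [Semigroup S] [TopologicalSpace S] [SeparatelyContinuousMul S] :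
    StarSubalgebra ℂ (S →ᵇ ℂ) where
  carrier := {f | ∀ μ : WeakDual.characterSpace ℂ (S →ᵇ ℂ),
    Continuous fun s : S => μ (leftTranslate s f)}
  mul_mem' {f g} hf hg μ := by
    have h : (fun s : S => μ (leftTranslate s (f * g))) =
        fun s => μ (leftTranslate s f) * μ (leftTranslate s g) := by
      funext s
      rw [← map_mul]
      rfl
    rw [h]
    exact (hf μ).mul (hg μ)
  add_mem' {f g} hf hg μ := by
    have h : (fun s : S => μ (leftTranslate s (f + g))) =
        fun s => μ (leftTranslate s f) + μ (leftTranslate s g) := by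
      funext s
      rw [← map_add]
      rfl
    rw [h]
    exact (hf μ).add (hg μ)
  algebraMap_mem' c μ := by
    have h : (fun s : S => μ (leftTranslate s (algebraMap ℂ (S →ᵇ ℂ) c))) =
        fun _ => μ (algebraMap ℂ (S →ᵇ ℂ) c) := by
      funext s
      rfl
    rw [h]
    exact continuous_const
  star_mem' {f} hf μ := by
    have h : (fun s : S => μ (leftTranslate s (star f))) =
        fun s => star (μ (leftTranslate s f)) := by
      funext s
      rw [← map_star]
      rfl
    rw [h]
    exact (hf μ).star

/-- `LMC(S)` is left translation invariant. -/
theorem leftTranslate_mem_LMC {S : Type*} [Semigroup S] [TopologicalSpace S]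
    [SeparatelyContinuousMul S] (s : S) {f : S →ᵇ ℂ} (hf : f ∈ LMC S) :
    leftTranslate s f ∈ LMC S := by
  intro μ
  have h : (fun t : S => μ (leftTranslate t (leftTranslate s f))) =
      fun t => μ (leftTranslate (s * t) f) := by
    funext t
    congr 1
    ext x
    exact congrArg f (mul_assoc s t x).symm
  rw [h]
  exact (hf μ).comp (continuous_const_mul s)

/-- For `μ ∈ S^LMC`, the spectrum of the algebra `LMC(S)`, and `f ∈ LMC(S)`, the function
`T_μ f : s ↦ μ (L_s f)`. The set `Σ` consists of the operators `T_μ`, `μ ∈ S^LMC`. -/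
def T {S : Type*} [Semigroup S] [TopologicalSpace S] [SeparatelyContinuousMul S]
    (μ : WeakDual.characterSpace ℂ (LMC S)) (f : LMC S) : S → ℂ :=
  fun s => μ ⟨leftTranslate s (f : S →ᵇ ℂ), leftTranslate_mem_LMC s f.2⟩

/-- The sets `F_k`: `F_0` is the set of constant functions of modulus one, and `F_(k+1)` is the set
of `f ∈ LMC(S)` of modulus one such that for every `σ = T_μ ∈ Σ` there is `f_σ ∈ F_k` with
`σ(f) = f_σ f`. -/
def F (S : Type*) [Semigroup S] [TopologicalSpace S] [SeparatelyContinuousMul S] :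
    ℕ → Set (S →ᵇ ℂ)
  | 0 => {f | ∃ c : ℂ, ‖c‖ = 1 ∧ f = BoundedContinuousFunction.const S c}
  | k + 1 => {f | ∃ hf : f ∈ LMC S, (∀ s, ‖f s‖ = 1) ∧
      ∀ μ : WeakDual.characterSpace ℂ (LMC S), ∃ g ∈ F S k, ∀ s, T μ ⟨f, hf⟩ s = g s * f s}

/-- `W_k(S)`: the norm closure in `C(S)` of the algebra generated by `F_k`. (As `F_k` contains the
constant function `1`, the generated algebra is the generated unital algebra.) -/
def W (S : Type*) [Semigroup S] [TopologicalSpace S] [SeparatelyContinuousMul S] (k : ℕ) :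
    Subalgebra ℂ (S →ᵇ ℂ) :=
  (Algebra.adjoin ℂ (F S k)).topologicalClosure

/-- `f` is a coefficient of a continuous finite dimensional unitary representation of `S`:
`f(s) = ⟨U(s) ξ, η⟩` for a continuous homomorphism `U` into some unitary group `U(n)` and vectors
`ξ, η ∈ ℂⁿ`. -/
def IsUnitaryCoefficient {S : Type*} [Semigroup S] [TopologicalSpace S] (f : S →ᵇ ℂ) : Prop :=
  ∃ (n : ℕ) (U : S →ₙ* Matrix.unitaryGroup (Fin n) ℂ) (ξ η : Fin n → ℂ), Continuous U ∧
    ∀ s, f s = dotProduct (star η) (Matrix.mulVec (U s : Matrix (Fin n) (Fin n) ℂ) ξ)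

/-- `SAP(S)`, the strongly almost periodic functions: the closed linear span in `C(S)` of the
coefficients of the continuous finite dimensional unitary representations of `S`. -/
def SAP (S : Type*) [Semigroup S] [TopologicalSpace S] : Submodule ℂ (S →ᵇ ℂ) :=
  (Submodule.span ℂ {f : S →ᵇ ℂ | IsUnitaryCoefficient f}).topologicalClosure

end

end WeylAlgebra

/-!
On an abelian semigroup `S`, commuting unitary operators are simultaneously diagonalizable, and the
joint eigenvalues of a unitary representation are continuous unimodular characters; so `SAP(S)` is
the closed linear span of the unimodular characters. For `f ∈ F_1`, applying the definition to the
evaluation at `t ∈ S` gives `f (s * t) = χ t * f s` for all `s`, and such a `χ` is a unimodular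
character. By commutativity `χ t * f s = χ s * f t`, so `f` is a scalar multiple of `χ`. Hence
the algebra generated by `F_1` is the linear span of the unimodular characters.
-/

namespace WeylAlgebra

section JointEigenvectors

open Module Module.End

theorem iSup_iInf_eigenspace_eq_top_of_isSemisimple {ι K V : Type*} [Field K] [IsAlgClosed K]
    [AddCommGroup V] [Module K V] [FiniteDimensional K V] {f : ι → End K V}
    (hf : ∀ i, (f i).IsSemisimple) (hcomm : Pairwise fun i j ↦ Commute (f i) (f j)) :
    ⨆ χ : ι → K, ⨅ i, eigenspace (f i) (χ i) = ⊤ := by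
  have h := iSup_iInf_maxGenEigenspace_eq_top_of_iSup_maxGenEigenspace_eq_top_of_commute f hcomm
    fun i ↦ iSup_maxGenEigenspace_eq_top (f i)
  simpa only [(hf _).isFinitelySemisimple.maxGenEigenspace_eq_eigenspace] using h

variable {𝕜 E : Type*} [RCLike 𝕜] [NormedAddCommGroup E] [InnerProductSpace 𝕜 E]

theorem isSemisimple_linearIsometry [FiniteDimensional 𝕜 E] (f : E →ₗᵢ[𝕜] E) :
    IsSemisimple f.toLinearMap := by
  refine isSemisimple_iff.2 fun p hp ↦ ⟨pᗮ, fun x hx ↦ ?_, p.isCompl_orthogonal⟩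
  have hsurj : Function.Surjective (f.toLinearMap.restrict hp) :=
    LinearMap.injective_iff_surjective.1 fun y z hyz ↦
      Subtype.ext (f.injective (congrArg Subtype.val hyz))
  refine (Submodule.mem_orthogonal _ _).2 fun y hy ↦ ?_
  obtain ⟨z, hz⟩ := hsurj ⟨y, hy⟩
  obtain rfl : f z = y := congrArg Subtype.val hz
  exact (f.inner_map_map _ _).trans (Submodule.inner_right_of_mem_orthogonal z.2 hx)

end JointEigenvectors

section UnimodularCharacters

variable {S : Type*} [TopologicalSpace S]

/-- The continuous unimodular characters of `S`, i.e. the continuous homomorphisms from `S` to the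
unit circle. They are encoded as elements of `C(S)`, in which they form a multiplicative
submonoid. -/
def unimodularCharacters (S : Type*) [Mul S] [TopologicalSpace S] : Submonoid (S →ᵇ ℂ) where
  carrier := {χ | (∀ s t, χ (s * t) = χ s * χ t) ∧ ∀ s, ‖χ s‖ = 1}
  one_mem' := ⟨fun _ _ ↦ (one_mul 1).symm, fun _ ↦ norm_one⟩
  mul_mem' {χ ψ} hχ hψ :=
    ⟨fun s t ↦ by simp only [BoundedContinuousFunction.mul_apply, hχ.1, hψ.1, mul_mul_mul_comm],
      fun s ↦ by simp only [BoundedContinuousFunction.mul_apply, norm_mul, hχ.2, hψ.2, mul_one]⟩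

theorem exists_mem_unimodularCharacters [Mul S] {χ : S → ℂ} (hcont : Continuous χ)
    (hmul : ∀ s t, χ (s * t) = χ s * χ t) (hnorm : ∀ s, ‖χ s‖ = 1) :
    ∃ ψ ∈ unimodularCharacters S, ⇑ψ = χ :=
  ⟨.ofNormedAddCommGroup χ hcont 1 fun s ↦ (hnorm s).le, ⟨hmul, hnorm⟩, rfl⟩

theorem isUnitaryCoefficient_of_mem_unimodularCharacters [Semigroup S] {χ : S →ᵇ ℂ}
    (hχ : χ ∈ unimodularCharacters S) : IsUnitaryCoefficient χ := by
  have hmem (s : S) : Matrix.diagonal (fun _ : Fin 1 ↦ χ s) ∈ Matrix.unitaryGroup (Fin 1) ℂ := by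
    simp [Matrix.mem_unitaryGroup_iff, Matrix.star_eq_conjTranspose, Matrix.diagonal_conjTranspose,
      Complex.mul_conj', hχ.2 s]
  refine ⟨1, ⟨fun s ↦ ⟨_, hmem s⟩, fun s t ↦ Subtype.ext ?_⟩, 1, 1,
    .subtype_mk (.matrix_diagonal (continuous_pi fun _ ↦ χ.continuous)) _, fun s ↦ ?_⟩
  · simp [hχ.1]
  · simp [dotProduct]

end UnimodularCharacters

section UnitaryRepresentations

variable {S E : Type*} [TopologicalSpace S] [NormedAddCommGroup E] [InnerProductSpace ℂ E]

theorem exists_mem_unimodularCharacters_of_forall_apply_eq_smul [Mul S]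
    {ρ : S →ₙ* (E ≃ₗᵢ[ℂ] E)} {v : E} (hv : v ≠ 0) (hcont : Continuous fun s ↦ ρ s v) {χ : S → ℂ}
    (hχ : ∀ s, ρ s v = χ s • v) : ∃ ψ ∈ unimodularCharacters S, ⇑ψ = χ := by
  refine exists_mem_unimodularCharacters ?_ (fun s t ↦ smul_left_injective ℂ hv ?_) fun s ↦ ?_
  · have hχ_eq : χ = fun s ↦ inner ℂ v (ρ s v) / inner ℂ v v := by
      funext s
      rw [hχ, inner_smul_right, mul_div_cancel_right₀ _ (inner_self_ne_zero.2 hv)]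
    rw [hχ_eq]
    exact (continuous_const.inner hcont).div_const _
  · calc χ (s * t) • v = ρ s (ρ t v) := by rw [← hχ, map_mul, LinearIsometryEquiv.coe_mul]; rfl
      _ = (χ s * χ t) • v := by rw [hχ, map_smul, hχ, smul_smul, mul_comm]
  · have hnorm : ‖χ s‖ * ‖v‖ = ‖v‖ := by rw [← norm_smul, ← hχ, LinearIsometryEquiv.norm_map]
    exact (mul_eq_right₀ (norm_ne_zero_iff.2 hv)).1 hnorm

/-- The linear map sending a vector `v` to the coefficient `s ↦ φ (ρ s v)` of a strongly continuous
unitary representation `ρ`, for a fixed continuous functional `φ`. -/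
noncomputable def coefficient [Mul S] (ρ : S →ₙ* (E ≃ₗᵢ[ℂ] E))
    (hρ : ∀ v, Continuous fun s ↦ ρ s v) (φ : E →L[ℂ] ℂ) : E →ₗ[ℂ] S →ᵇ ℂ where
  toFun v := .ofNormedAddCommGroup (fun s ↦ φ (ρ s v)) (φ.continuous.comp (hρ v)) (‖φ‖ * ‖v‖)
    fun s ↦ (φ.le_opNorm _).trans_eq (by rw [LinearIsometryEquiv.norm_map])
  map_add' v w := by ext; simp
  map_smul' c v := by ext; simp

theorem coefficient_mem_span_unimodularCharacters [CommSemigroup S] [FiniteDimensional ℂ E]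
    (ρ : S →ₙ* (E ≃ₗᵢ[ℂ] E)) (hρ : ∀ v, Continuous fun s ↦ ρ s v) (φ : E →L[ℂ] ℂ) (v : E) :
    coefficient ρ hρ φ v ∈ Submodule.span ℂ (unimodularCharacters S : Set (S →ᵇ ℂ)) := by
  have htop : ⨆ χ : S → ℂ,
      ⨅ s, Module.End.eigenspace (ρ s).toLinearIsometry.toLinearMap (χ s) = ⊤ :=
    iSup_iInf_eigenspace_eq_top_of_isSemisimple (fun s ↦ isSemisimple_linearIsometry _)
      fun s t _ ↦ LinearMap.ext fun w ↦
        congrArg (fun u : E ≃ₗᵢ[ℂ] E ↦ u w) ((Commute.all s t).map ρ).eq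
  suffices h : ⊤ ≤ (Submodule.span ℂ (unimodularCharacters S : Set (S →ᵇ ℂ))).comap
      (coefficient ρ hρ φ) from h trivial
  rw [← htop]
  refine iSup_le fun χ w hw ↦ ?_
  rcases eq_or_ne w 0 with rfl | hw0
  · exact zero_mem _
  have hχ (s : S) : ρ s w = χ s • w :=
    Module.End.mem_eigenspace_iff.1 ((Submodule.mem_iInf _).1 hw s)
  obtain ⟨ψ, hψ, rfl⟩ := exists_mem_unimodularCharacters_of_forall_apply_eq_smul hw0 (hρ w) hχ
  have hcoeff : coefficient ρ hρ φ w = φ w • ψ := by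
    ext s
    simp [coefficient, hχ, mul_comm]
  exact Submodule.mem_comap.2 (hcoeff ▸ Submodule.smul_mem _ _ (Submodule.subset_span hψ))

theorem IsUnitaryCoefficient.exists_eq_coefficient [Semigroup S] {f : S →ᵇ ℂ}
    (hf : IsUnitaryCoefficient f) :
    ∃ (n : ℕ) (ρ : S →ₙ* (EuclideanSpace ℂ (Fin n) ≃ₗᵢ[ℂ] EuclideanSpace ℂ (Fin n)))
      (hρ : ∀ v, Continuous fun s ↦ ρ s v) (φ : EuclideanSpace ℂ (Fin n) →L[ℂ] ℂ)
      (v : EuclideanSpace ℂ (Fin n)), f = coefficient ρ hρ φ v := by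
  obtain ⟨n, U, ξ, η, hU, hf⟩ := hf
  let ρ : S →ₙ* (EuclideanSpace ℂ (Fin n) ≃ₗᵢ[ℂ] EuclideanSpace ℂ (Fin n)) :=
    { toFun s := Unitary.linearIsometryEquiv
        ⟨Matrix.toEuclideanCLM (𝕜 := ℂ) (U s : Matrix (Fin n) (Fin n) ℂ),
          Unitary.map_mem _ (U s).2⟩
      map_mul' s t := by
        rw [← map_mul]
        exact congrArg _ (Subtype.ext (by simp)) }
  have hρ (v : EuclideanSpace ℂ (Fin n)) : Continuous fun s ↦ ρ s v :=
    (PiLp.continuous_toLp 2 _).comp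
      ((continuous_subtype_val.comp hU).matrix_mulVec continuous_const)
  refine ⟨n, ρ, hρ, innerSL ℂ (WithLp.toLp 2 η), WithLp.toLp 2 ξ, ?_⟩
  ext s
  rw [hf]
  exact dotProduct_comm _ _

end UnitaryRepresentations

theorem SAP_eq_topologicalClosure_span {S : Type*} [CommSemigroup S] [TopologicalSpace S] :
    SAP S =
      (Submodule.span ℂ (unimodularCharacters S : Set (S →ᵇ ℂ))).topologicalClosure := by
  refine congrArg Submodule.topologicalClosure (le_antisymm (Submodule.span_le.2 fun f hf ↦ ?_)
    (Submodule.span_mono fun χ ↦ isUnitaryCoefficient_of_mem_unimodularCharacters))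
  obtain ⟨n, ρ, hρ, φ, v, rfl⟩ := IsUnitaryCoefficient.exists_eq_coefficient hf
  exact coefficient_mem_span_unimodularCharacters ρ hρ φ v

section Spectrum

open WeakDual

variable {A : Type*} [NormedRing A] [NormedAlgebra ℂ A] [StarRing A] [CStarRing A]

theorem norm_apply_le_one_of_mem_unitary (μ : characterSpace ℂ A) {u : A}
    (hu : u ∈ unitary A) : ‖μ u‖ ≤ 1 := by
  by_contra! h
  obtain ⟨n, hn⟩ := pow_unbounded_of_one_lt (‖toStrongDual (μ : WeakDual ℂ A)‖ * ‖(1 : A)‖) h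
  refine hn.not_ge ?_
  calc ‖μ u‖ ^ n = ‖μ (u ^ n)‖ := by rw [map_pow, norm_pow]
    _ ≤ ‖toStrongDual (μ : WeakDual ℂ A)‖ * ‖u ^ n * 1‖ := by
      rw [mul_one]
      exact (toStrongDual (μ : WeakDual ℂ A)).le_opNorm _
    _ = ‖toStrongDual (μ : WeakDual ℂ A)‖ * ‖(1 : A)‖ := by
      rw [CStarRing.norm_mem_unitary_mul _ (pow_mem hu n)]

theorem norm_apply_eq_one_of_mem_unitary (μ : characterSpace ℂ A) {u : A}
    (hu : u ∈ unitary A) : ‖μ u‖ = 1 := by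
  refine (norm_apply_le_one_of_mem_unitary μ hu).antisymm ?_
  calc 1 = ‖μ u‖ * ‖μ (star u)‖ := by
        rw [← norm_mul, ← map_mul, Unitary.mul_star_self_of_mem hu, map_one, norm_one]
    _ ≤ ‖μ u‖ := mul_le_of_le_one_right (norm_nonneg _)
        (norm_apply_le_one_of_mem_unitary μ (Unitary.star_mem hu))

end Spectrum

section Evaluation

open WeakDual

variable {S : Type*} [TopologicalSpace S]

theorem mem_unitary_of_forall_norm_eq_one {A : StarSubalgebra ℂ (S →ᵇ ℂ)} {f : A}
    (hf : ∀ s, ‖(f : S →ᵇ ℂ) s‖ = 1) : f ∈ unitary A := by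
  have h : star f * f = 1 := by
    ext s
    simp [Complex.conj_mul', hf s]
  exact Unitary.mem_iff.2 ⟨h, (mul_comm _ _).trans h⟩

/-- Evaluation at a point of `S`, as a point of the spectrum of a subalgebra of `C(S)`. -/
noncomputable def evalCharacter (A : StarSubalgebra ℂ (S →ᵇ ℂ)) (s : S) : characterSpace ℂ A :=
  ⟨(BoundedContinuousFunction.evalCLM ℂ s).comp A.toSubalgebra.toSubmodule.subtypeL,
    CharacterSpace.eq_set_map_one_map_mul.ge ⟨rfl, fun _ _ ↦ rfl⟩⟩

end Evaluation

section Filtration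

variable {S : Type*} [Semigroup S] [TopologicalSpace S] [SeparatelyContinuousMul S]

theorem leftTranslate_eq_smul {χ : S →ᵇ ℂ} (hχ : χ ∈ unimodularCharacters S) (s : S) :
    leftTranslate s χ = χ s • χ :=
  BoundedContinuousFunction.ext fun t ↦ hχ.1 s t

theorem unimodularCharacters_subset_LMC : (unimodularCharacters S : Set (S →ᵇ ℂ)) ⊆ LMC S := by
  intro χ hχ μ
  simp only [leftTranslate_eq_smul hχ, map_smul]
  exact χ.continuous.smul continuous_const

theorem unimodularCharacters_subset_F_one : (unimodularCharacters S : Set (S →ᵇ ℂ)) ⊆ F S 1 := by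
  intro χ hχ
  have hLMC := unimodularCharacters_subset_LMC hχ
  refine ⟨hLMC, hχ.2, fun μ ↦ ⟨_, ⟨μ ⟨χ, hLMC⟩, ?_, rfl⟩, fun s ↦ ?_⟩⟩
  · exact norm_apply_eq_one_of_mem_unitary μ (mem_unitary_of_forall_norm_eq_one hχ.2)
  · calc T μ ⟨χ, hLMC⟩ s = μ (χ s • ⟨χ, hLMC⟩) :=
          congrArg μ (Subtype.ext (leftTranslate_eq_smul hχ s))
      _ = μ ⟨χ, hLMC⟩ * χ s := by rw [map_smul, smul_eq_mul, mul_comm]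

theorem F_zero_subset_F_one : F S 0 ⊆ F S 1 := by
  rintro _ ⟨c, hc, rfl⟩
  refine ⟨(LMC S).algebraMap_mem c, fun _ ↦ hc, fun μ ↦ ⟨_, ⟨1, norm_one, rfl⟩, fun _ ↦ ?_⟩⟩
  calc μ (algebraMap ℂ (LMC S) c) = c := AlgHomClass.commutes μ c
    _ = 1 * c := (one_mul c).symm

theorem F_monotone : Monotone (F S) := by
  refine monotone_nat_of_le_succ fun k ↦ ?_
  induction k with
  | zero => exact F_zero_subset_F_one
  | succ k ih =>
    rintro f ⟨hf, hnorm, h⟩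
    refine ⟨hf, hnorm, fun μ ↦ ?_⟩
    obtain ⟨g, hg, hg_eq⟩ := h μ
    exact ⟨g, ih hg, hg_eq⟩

theorem W_monotone : Monotone (W S) := fun _ _ h ↦
  closure_mono (Algebra.adjoin_mono (F_monotone h))

theorem exists_unimodularCharacter_of_mem_F_one [Nonempty S] {f : S →ᵇ ℂ} (hf : f ∈ F S 1) :
    ∃ χ ∈ unimodularCharacters S, ∀ s t, f (s * t) = χ t * f s := by
  obtain ⟨hLMC, hnorm, hT⟩ := hf
  have hT_eval (t : S) : ∃ c : ℂ, ‖c‖ = 1 ∧ ∀ s, f (s * t) = c * f s := by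
    obtain ⟨_, ⟨c, hc, rfl⟩, h⟩ := hT (evalCharacter (LMC S) t)
    exact ⟨c, hc, h⟩
  choose χ hχ_norm hχ using hT_eval
  obtain ⟨s₀⟩ := ‹Nonempty S›
  have hf_ne : f s₀ ≠ 0 := norm_ne_zero_iff.1 (hnorm s₀ ▸ one_ne_zero)
  have hχ_eq : χ = fun t ↦ f (s₀ * t) / f s₀ :=
    funext fun t ↦ eq_div_of_mul_eq hf_ne (hχ t s₀).symm
  have hcont : Continuous χ := by
    rw [hχ_eq]
    exact (f.continuous.comp (continuous_const_mul s₀)).div_const _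
  have hmul (s t : S) : χ (s * t) = χ s * χ t := by
    refine mul_right_cancel₀ hf_ne ?_
    rw [← hχ, ← mul_assoc, hχ, hχ]
    ring
  obtain ⟨ψ, hψ, rfl⟩ := exists_mem_unimodularCharacters hcont hmul hχ_norm
  exact ⟨ψ, hψ, fun s t ↦ hχ t s⟩

end Filtration

section Commutative

variable {S : Type*} [CommSemigroup S] [TopologicalSpace S] [SeparatelyContinuousMul S]

theorem exists_eq_smul_unimodularCharacter_of_mem_F_one {f : S →ᵇ ℂ} (hf : f ∈ F S 1) :
    ∃ c : ℂ, ∃ χ ∈ unimodularCharacters S, f = c • χ := by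
  rcases isEmpty_or_nonempty S with _ | hS
  · exact ⟨1, 1, one_mem _, BoundedContinuousFunction.ext isEmptyElim⟩
  obtain ⟨χ, hχ, hfχ⟩ := exists_unimodularCharacter_of_mem_F_one hf
  obtain ⟨s₀⟩ := hS
  have hχ_ne : χ s₀ ≠ 0 := norm_ne_zero_iff.1 (hχ.2 s₀ ▸ one_ne_zero)
  refine ⟨f s₀ / χ s₀, χ, hχ, BoundedContinuousFunction.ext fun s ↦ ?_⟩
  have hsymm : χ s₀ * f s = χ s * f s₀ := by rw [← hfχ, mul_comm, hfχ]
  rw [BoundedContinuousFunction.smul_apply, smul_eq_mul, div_mul_eq_mul_div,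
    eq_div_iff hχ_ne, mul_comm, hsymm, mul_comm]

theorem adjoin_F_one : Algebra.adjoin ℂ (F S 1) = Algebra.adjoin ℂ (unimodularCharacters S) := by
  refine le_antisymm (Algebra.adjoin_le fun f hf ↦ ?_)
    (Algebra.adjoin_mono unimodularCharacters_subset_F_one)
  obtain ⟨c, χ, hχ, rfl⟩ := exists_eq_smul_unimodularCharacter_of_mem_F_one hf
  exact Subalgebra.smul_mem _ (Algebra.subset_adjoin hχ) c

theorem toSubmodule_W_one_eq_SAP : Subalgebra.toSubmodule (W S 1) = SAP S := by
  have hspan : Subalgebra.toSubmodule (Algebra.adjoin ℂ (F S 1)) =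
      Submodule.span ℂ (unimodularCharacters S) := by
    rw [adjoin_F_one, Algebra.adjoin_eq_span, Submonoid.closure_eq]
  rw [SAP_eq_topologicalClosure_span, ← hspan]
  rfl

end Commutative

end WeylAlgebra

theorem proposition3p7_general (S : Type*) [CommSemigroup S] [TopologicalSpace S]
    [SeparatelyContinuousMul S] :
    (∀ k : ℕ, 1 ≤ k → (WeylAlgebra.SAP S : Set (S →ᵇ ℂ)) ⊆ WeylAlgebra.W S k) ∧
      (WeylAlgebra.W S 1 : Set (S →ᵇ ℂ)) = WeylAlgebra.SAP S := by
  have hW : (WeylAlgebra.W S 1 : Set (S →ᵇ ℂ)) = WeylAlgebra.SAP S :=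
    congrArg SetLike.coe WeylAlgebra.toSubmodule_W_one_eq_SAP
  exact ⟨fun k hk ↦ hW.symm.trans_subset (WeylAlgebra.W_monotone hk), hW⟩

theorem proposition3p7 :
    (∀ (S : Type*) [CommSemigroup S] [TopologicalSpace S] [SeparatelyContinuousMul S] (k : ℕ),
      1 ≤ k → (WeylAlgebra.SAP S : Set (S →ᵇ ℂ)) ⊆ (WeylAlgebra.W S k : Set (S →ᵇ ℂ))) ∧
    (∀ (S : Type*) [CommSemigroup S] [TopologicalSpace S] [SeparatelyContinuousMul S],
      (∃ e : S, ∀ s : S, e * s = s) →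
        (WeylAlgebra.W S 1 : Set (S →ᵇ ℂ)) = (WeylAlgebra.SAP S : Set (S →ᵇ ℂ))) :=
  ⟨fun S _ _ _ ↦ (proposition3p7_general S).1, fun S _ _ _ _ ↦ (proposition3p7_general S).2⟩
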